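/- Let $K$ be a field, let $S=K[y_1,\dots,y_n]$ be a polynomial ring in finitely many variables over $K$, and let $I\subseteq S$ be a square-free monomial ideal (an ideal generated by square-free monomials). Let $\Lambda$ be any subset of the variables, and let $x_1,\dots,x_i$ be its distinct elements, listed in any order. Then either there exists $j$ with $1\le j\le i$ such that \[ \operatorname{pd}(S/I)=\operatorname{pd}\bigl(S/((I,x_1,\dots,x_{j-1}):x_j)\bigr), \] or \[ \operatorname{pd}(S/I)=\operatorname{pd}\bigl(S/(I,x_1,\dots,x_i)\bigr). \] Here $\operatorname{pd}$ is the projective dimension over $S$ (that of the zero module being $-\infty$), $(J:x)=\{f\in S: fx\in J\}$, and for $j=1$ the ideal $(I,x_1,\dots,x_{j-1})$ is $I$. -/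

import Mathlib

open CategoryTheory

/-- A square-free monomial ideal of a polynomial ring: an ideal generated by a set of square-free
monomials `∏ v ∈ F, X v`, each determined by its (finite) set of variables `F`. -/
def IsSquarefreeMonomialIdeal {σ k : Type*} [Field k] (I : Ideal (MvPolynomial σ k)) : Prop :=
  ∃ A : Set (Finset σ),
    I = Ideal.span ((fun F : Finset σ => ∏ v ∈ F, (MvPolynomial.X v : MvPolynomial σ k)) '' A)

/-- The projective dimension of the `S`-module `S ⧸ I` (it is `⊥` exactly when `I = S`). -/
noncomputable def quotientPd {S : Type*} [CommRing S] (I : Ideal S) : WithBot ℕ∞ :=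
  projectiveDimension (ModuleCat.of S (S ⧸ I))

-- The heart is `pd S/(I : v) ≤ pd S/I` for a variable `v`. Write `S = R[v]`, with `R` the
-- polynomial ring in the other variables. Square-freeness makes the generators of `I` have the form
-- `r` or `r * v`, so `(I : v)` is extended from `J = {r | r * v ∈ I}`, and `R/J` is an `R`-module
-- retract of `S/I`, sitting in `v`-degree one. Restricting to `R` (`S` is `R`-free) and extending
-- back to `S` (flat) do not raise projective dimension. If the inequality is strict, `0 → S/(I : v)
-- → S/I → S/(I, v) → 0` forces `pd S/I = pd S/(I, v)`. Adjoining the variables one at a time gives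
-- the theorem.

universe u

/-! ### Projective dimension under exact functors and change of rings -/

open Limits in
/-- An exact functor preserving projective objects does not raise the projective dimension. -/
lemma CategoryTheory.Functor.hasProjectiveDimensionLT_obj {C D : Type*} [Category C] [Category D]
    [Abelian C] [Abelian D] [EnoughProjectives C] (F : C ⥤ D) [F.Additive]
    [PreservesFiniteLimits F] [PreservesFiniteColimits F] [F.PreservesProjectiveObjects]
    (n : ℕ) (X : C) (h : HasProjectiveDimensionLT X n) :
    HasProjectiveDimensionLT (F.obj X) n := by
  induction n generalizing X with
  | zero =>
    rw [hasProjectiveDimensionLT_zero_iff_isZero] at h ⊢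
    exact F.map_isZero h
  | succ n ih =>
    -- Dimension shifting only relates bounds `n + 2` and `n + 1`, so the projective case is
    -- separate.
    rcases n with _ | n
    · rw [zero_add, ← projective_iff_hasProjectiveDimensionLT_one] at h ⊢
      exact F.projective_obj_of_projective h
    · obtain ⟨⟨P, f⟩⟩ := EnoughProjectives.presentation X
      let T := ShortComplex.mk (kernel.ι f) f (kernel.condition f)
      have hT : T.ShortExact := { exact := ShortComplex.exact_kernel f }
      have hFT : (T.map F).ShortExact := hT.map_of_exact F
      have hP : Projective (T.map F).X₂ := F.projective_obj P
      exact (hFT.hasProjectiveDimensionLT_X₃_iff n hP).mpr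
        (ih _ ((hT.hasProjectiveDimensionLT_X₃_iff n ‹_›).mp h))

lemma projectiveDimension_le_of_forall_hasProjectiveDimensionLT {C D : Type*} [Category C]
    [Category D] [Abelian C] [Abelian D] {X : C} {Y : D}
    (h : ∀ n, HasProjectiveDimensionLT X n → HasProjectiveDimensionLT Y n) :
    projectiveDimension Y ≤ projectiveDimension X :=
  sInf_le_sInf fun _ hn i hi ↦ h i (hn i hi)

/-- `M` is an `S`-summand of a direct sum of copies of `S`, which is projective over `R`. -/
lemma Module.Projective.restrictScalars_of_projective (R S : Type*) {M : Type*} [CommRing R]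
    [CommRing S] [Algebra R S] [AddCommGroup M] [Module R M] [Module S M] [IsScalarTower R S M]
    [Module.Projective R S] [Module.Projective S M] : Module.Projective R M := by
  classical
  obtain ⟨s, hs⟩ := (Module.projective_def' (R := S) (P := M)).mp inferInstance
  have : Module.Projective R (M →₀ S) :=
    Module.Projective.of_equiv (finsuppLEquivDirectSum R S M).symm
  refine Module.Projective.of_split (s.restrictScalars R)
    ((Finsupp.linearCombination S id).restrictScalars R) ?_
  exact LinearMap.ext fun m ↦ LinearMap.congr_fun hs m

lemma ModuleCat.preservesProjectiveObjects_restrictScalars {R S : Type u} [CommRing R]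
    [CommRing S] [Algebra R S] [Module.Projective R S] :
    (ModuleCat.restrictScalars.{u} (algebraMap R S)).PreservesProjectiveObjects where
  projective_obj {X} hX := by
    rw [← IsProjective.iff_projective] at hX ⊢
    let := Module.compHom X (algebraMap R S)
    have : IsScalarTower R S X := .of_algebraMap_smul fun _ _ ↦ rfl
    exact Module.Projective.restrictScalars_of_projective R S (M := X)

lemma projectiveDimension_restrictScalars_le {R S : Type u} [CommRing R] [CommRing S] [Algebra R S]
    [Module.Projective R S] (M : ModuleCat.{u} S) :
    projectiveDimension ((ModuleCat.restrictScalars (algebraMap R S)).obj M) ≤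
      projectiveDimension M := by
  have := ModuleCat.preservesProjectiveObjects_restrictScalars (R := R) (S := S)
  exact projectiveDimension_le_of_forall_hasProjectiveDimensionLT fun n h ↦
    (ModuleCat.restrictScalars (algebraMap R S)).hasProjectiveDimensionLT_obj n M h

lemma projectiveDimension_extendScalars_le {R S : Type u} [CommRing R] [CommRing S]
    {f : R →+* S} (hf : f.Flat) (M : ModuleCat.{u} R) :
    projectiveDimension ((ModuleCat.extendScalars.{_, _, u} f).obj M) ≤
      projectiveDimension M := by
  let F := ModuleCat.extendScalars.{u, u, u} f
  have adj : F ⊣ _ := ModuleCat.extendRestrictScalarsAdj.{u, u, u} f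
  have : Limits.PreservesFiniteLimits F :=
    ModuleCat.preservesFiniteLimits_extendScalars_of_flat hf
  have : Limits.PreservesFiniteColimits F := ⟨fun _ _ _ ↦ adj.leftAdjoint_preservesColimits.1⟩
  have : F.Additive := adj.left_adjoint_additive
  have : F.PreservesProjectiveObjects :=
    Functor.preservesProjectiveObjects_of_adjunction_of_preservesEpimorphisms adj
  exact projectiveDimension_le_of_forall_hasProjectiveDimensionLT fun n h ↦
    F.hasProjectiveDimensionLT_obj n M h

lemma quotientPd_map_le_of_flat {R S : Type u} [CommRing R] [CommRing S] {f : R →+* S}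
    (hf : f.Flat) (J : Ideal R) : quotientPd (J.map f) ≤ quotientPd J := by
  let := f.toAlgebra
  let e : (S ⧸ J.map f) ≃ₗ[S] TensorProduct R S (R ⧸ J) :=
    (Algebra.TensorProduct.quotIdealMapEquivTensorQuot S J).toLinearEquiv
  have h := ModuleCat.projectiveDimension_eq_of_linearEquiv (R := S)
    (M := ModuleCat.of S (S ⧸ J.map f))
    (N := (ModuleCat.extendScalars.{_, _, u} f).obj (ModuleCat.of R (R ⧸ J))) e
  exact h.trans_le (projectiveDimension_extendScalars_le hf (ModuleCat.of R (R ⧸ J)))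

lemma quotientPd_map_ringEquiv {R S : Type u} [CommRing R] [CommRing S] (e : R ≃+* S)
    (I : Ideal R) : quotientPd (I.map (e : R →+* S)) = quotientPd I := by
  have : RingHomInvPair (RingHomClass.toRingHom e) (RingHomClass.toRingHom e.symm) :=
    .of_ringEquiv e
  have : RingHomInvPair (RingHomClass.toRingHom e.symm) (RingHomClass.toRingHom e) :=
    .of_ringEquiv e.symm
  let e' := Ideal.quotientEquiv I _ e rfl
  exact (ModuleCat.projectiveDimension_eq_of_semiLinearEquiv (M := ModuleCat.of R (R ⧸ I))
    (N := ModuleCat.of S (S ⧸ I.map (e : R →+* S))) e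
    { e' with map_smul' := fun r m ↦ e'.map_mul (Ideal.Quotient.mk I r) m }).symm

/-- If some `R`-module `R ⧸ J` is a retract of `S ⧸ I`, where `S` is a projective `R`-module, then
the extension of `J` to `S` has at most the projective dimension of `I`. -/
lemma quotientPd_map_le_of_retract {R S : Type u} [CommRing R] [CommRing S] [Algebra R S]
    [Module.Projective R S] {J : Ideal R} {I : Ideal S} (f : (R ⧸ J) →ₗ[R] (S ⧸ I))
    (g : (S ⧸ I) →ₗ[R] (R ⧸ J)) (h : g ∘ₗ f = LinearMap.id) :
    quotientPd (J.map (algebraMap R S)) ≤ quotientPd I := by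
  refine (quotientPd_map_le_of_flat (RingHom.flat_algebraMap_iff.mpr inferInstance) J).trans ?_
  refine le_trans ?_ (projectiveDimension_restrictScalars_le (R := R) (ModuleCat.of S (S ⧸ I)))
  let M : ModuleCat.{u} R := (ModuleCat.restrictScalars (algebraMap R S)).obj (ModuleCat.of S (S ⧸ I))
  let e' : (ModuleCat.of R (S ⧸ I)) ≃ₗ[R] M :=
    { AddEquiv.refl (S ⧸ I) with map_smul' := fun r m ↦ (algebraMap_smul S r m).symm }
  let e : ModuleCat.of R (S ⧸ I) ≅ M := e'.toModuleIso
  let r : Retract (ModuleCat.of R (R ⧸ J)) (ModuleCat.of R (S ⧸ I)) :=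
    { i := ModuleCat.ofHom f, r := ModuleCat.ofHom g
      retract := by rw [← ModuleCat.ofHom_comp, h]; rfl }
  exact r.projectiveDimension_le.trans (projectiveDimension_eq_of_iso e).le

/-! ### The colon by `X` in `R[X]` -/

section PolynomialRing

open Polynomial

variable {R : Type u} [CommRing R] {G : Set R[X]}

/-- For an ideal of `R[X]` generated by elements `r` and `r * X`, the constant coefficient of an
element of the ideal lies in the ideal, and so do all its coefficients after multiplication
by `X`. -/
lemma Polynomial.C_coeff_mem_span (hG : ∀ g ∈ G, ∃ r, g = C r ∨ g = C r * X) {f : R[X]}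
    (hf : f ∈ Ideal.span G) :
    C (f.coeff 0) ∈ Ideal.span G ∧ ∀ n, C (f.coeff n) * X ∈ Ideal.span G := by
  induction hf using Submodule.span_induction with
  | zero => simp
  | add f g _ _ hf hg =>
    simpa [add_mul] using
      And.intro (add_mem hf.1 hg.1) fun n ↦ add_mem (hf.2 n) (hg.2 n)
  | mem f hf =>
    obtain ⟨r, rfl | rfl⟩ := hG f hf
    · have h := Ideal.subset_span hf
      refine ⟨by simpa using h, fun n ↦ ?_⟩
      rcases n with _ | n
      · simpa using Ideal.mul_mem_right X _ h
      · simp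
    · refine ⟨by simp, fun n ↦ ?_⟩
      by_cases hn : n = 1
      · subst hn
        simpa using Ideal.subset_span hf
      · simp [coeff_X, Ne.symm hn]
  | smul p f _ ih =>
    refine ⟨by simpa [mul_coeff_zero] using Ideal.mul_mem_left _ _ ih.1, fun n ↦ ?_⟩
    rw [smul_eq_mul, coeff_mul, map_sum, Finset.sum_mul]
    refine sum_mem fun c _ ↦ ?_
    rw [C_mul, mul_assoc]
    exact Ideal.mul_mem_left _ _ (ih.2 _)

lemma quotientPd_colon_X_le (hG : ∀ g ∈ G, ∃ r, g = C r ∨ g = C r * X) :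
    quotientPd (Submodule.colon (Ideal.span G) {(X : R[X])}) ≤ quotientPd (Ideal.span G) := by
  set I := Ideal.span G with hI
  let J : Ideal R := (Submodule.colon I {(X : R[X])}).comap C
  have mem_J {r : R} : r ∈ J ↔ C r * X ∈ I := by
    simp [J, Submodule.mem_colon_singleton]
  have colon_eq : Submodule.colon I {(X : R[X])} = J.map (algebraMap R R[X]) := by
    refine le_antisymm (fun f hf ↦ ?_) Ideal.map_comap_le
    rw [Submodule.mem_colon_singleton, smul_eq_mul] at hf
    refine Ideal.mem_map_C_iff.mpr fun n ↦ mem_J.mpr ?_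
    -- The shift is there because `f.coeff n` is coefficient `n + 1` of `f * X`.
    simpa using (C_coeff_mem_span hG hf).2 (n + 1)
  rw [colon_eq]
  -- Degree one is the degree in which the coefficients of elements of `I` lie in `J` by definition.
  let f₀ : R →ₗ[R] R[X] := monomial 1
  let g₀ : R[X] →ₗ[R] R := lcoeff R 1
  let f : (R ⧸ J) →ₗ[R] (R[X] ⧸ I) := Submodule.mapQ J (I.restrictScalars R) f₀ fun r hr ↦ by
    simpa [f₀, ← C_mul_X_eq_monomial] using mem_J.mp hr
  let g : (R[X] ⧸ I) →ₗ[R] (R ⧸ J) := Submodule.mapQ (I.restrictScalars R) J g₀ fun p hp ↦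
    mem_J.mpr ((C_coeff_mem_span hG hp).2 1)
  refine quotientPd_map_le_of_retract f g (LinearMap.ext fun x ↦ ?_)
  obtain ⟨x, rfl⟩ := Ideal.Quotient.mk_surjective x
  change Ideal.Quotient.mk J (g₀ (f₀ x)) = _
  simp [f₀, g₀]

end PolynomialRing

/-! ### Square-free monomial ideals -/

section SquarefreeMonomial

open MvPolynomial

variable {σ k : Type*} [Field k] {I : Ideal (MvPolynomial σ k)}

lemma IsSquarefreeMonomialIdeal.sup_span_X (hI : IsSquarefreeMonomialIdeal I) (s : Set σ) :
    IsSquarefreeMonomialIdeal (I ⊔ Ideal.span ((X : σ → MvPolynomial σ k) '' s)) := by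
  obtain ⟨A, rfl⟩ := hI
  refine ⟨A ∪ (fun v ↦ {v}) '' s, ?_⟩
  rw [Set.image_union, Ideal.span_union, Set.image_image]
  simp

lemma Submodule.map_colon_singleton_ringEquiv {R S : Type*} [CommRing R] [CommRing S]
    (e : R ≃+* S) (I : Ideal R) (a : R) :
    Ideal.map (e : R →+* S) (Submodule.colon I {a}) =
      Submodule.colon (I.map (e : R →+* S)) {e a} := by
  ext y
  obtain ⟨y, rfl⟩ := e.surjective y
  have key (K : Ideal R) (z : R) : e z ∈ K.map (e : R →+* S) ↔ z ∈ K := by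
    rw [show K.map (e : R →+* S) = K.map e from rfl, ← Ideal.comap_symm, Ideal.mem_comap,
      e.symm_apply_apply]
  rw [key, Submodule.mem_colon_singleton, Submodule.mem_colon_singleton, smul_eq_mul, smul_eq_mul,
    ← map_mul, key]

lemma IsSquarefreeMonomialIdeal.quotientPd_colon_X_le (hI : IsSquarefreeMonomialIdeal I) (v : σ) :
    quotientPd (Submodule.colon I {(X v : MvPolynomial σ k)}) ≤ quotientPd I := by
  classical
  let e : MvPolynomial σ k ≃+* Polynomial (MvPolynomial {w // w ≠ v} k) :=
    ((renameEquiv k (Equiv.optionSubtypeNe v).symm).trans (optionEquivLeft k _)).toRingEquiv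
  have he : e (X v) = Polynomial.X := by simp [e]
  have he' (w : σ) (hw : w ≠ v) : e (X w) = Polynomial.C (X ⟨w, hw⟩) := by
    simp [e, Equiv.optionSubtypeNe_symm_of_ne hw]
  have hprod (F : Finset σ) (hF : v ∉ F) : ∃ r, e (∏ w ∈ F, X w) = Polynomial.C r := by
    refine ⟨∏ w ∈ F.attach, X ⟨w, fun h ↦ hF (h ▸ w.2)⟩, ?_⟩
    rw [map_prod, map_prod, ← Finset.prod_attach]
    exact Finset.prod_congr rfl fun w _ ↦ he' _ _
  obtain ⟨A, rfl⟩ := hI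
  rw [← quotientPd_map_ringEquiv e, ← quotientPd_map_ringEquiv e (Ideal.span _),
    Submodule.map_colon_singleton_ringEquiv, he, Ideal.map_span]
  refine _root_.quotientPd_colon_X_le ?_
  rintro _ ⟨_, ⟨F, hF, rfl⟩, rfl⟩
  by_cases hv : v ∈ F
  · obtain ⟨r, hr⟩ := hprod (F.erase v) (Finset.notMem_erase v F)
    refine ⟨r, .inr ?_⟩
    rw [← hr, ← he, ← map_mul, Finset.prod_erase_mul _ _ hv]
    rfl
  · obtain ⟨r, hr⟩ := hprod F hv
    exact ⟨r, .inl hr⟩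

end SquarefreeMonomial

/-! ### The exact sequence and the dichotomy -/

/-- The exact sequence `0 → S ⧸ (I : a) → S ⧸ I → S ⧸ (I, a) → 0`. -/
lemma exists_shortExact_colon {S : Type u} [CommRing S] (I : Ideal S) (a : S) :
    ∃ T : ShortComplex (ModuleCat.{u} S), T.ShortExact ∧
      T.X₁ = ModuleCat.of S (S ⧸ Submodule.colon I {a}) ∧ T.X₂ = ModuleCat.of S (S ⧸ I) ∧
      T.X₃ = ModuleCat.of S (S ⧸ (I ⊔ Ideal.span {a})) := by
  let f : (S ⧸ Submodule.colon I {a}) →ₗ[S] S ⧸ I :=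
    Submodule.mapQ _ _ (LinearMap.mulRight S a) fun r hr ↦ Submodule.mem_colon_singleton.mp hr
  let g : (S ⧸ I) →ₗ[S] S ⧸ (I ⊔ Ideal.span {a}) := Submodule.factor le_sup_left
  have hf : Function.Injective f := by
    rw [injective_iff_map_eq_zero]
    intro x hx
    obtain ⟨x, rfl⟩ := Ideal.Quotient.mk_surjective x
    refine Ideal.Quotient.eq_zero_iff_mem.mpr (Submodule.mem_colon_singleton.mpr ?_)
    exact Ideal.Quotient.eq_zero_iff_mem.mp hx
  have hg : Function.Surjective g := Submodule.factor_surjective _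
  have hfg : Function.Exact f g := by
    intro y
    obtain ⟨y, rfl⟩ := Ideal.Quotient.mk_surjective y
    constructor
    · intro hy
      have hy : y ∈ I ⊔ Ideal.span {a} := Ideal.Quotient.eq_zero_iff_mem.mp hy
      obtain ⟨z, hz, w, hw, rfl⟩ := Submodule.mem_sup.mp hy
      obtain ⟨c, rfl⟩ := Ideal.mem_span_singleton'.mp hw
      refine ⟨Ideal.Quotient.mk _ c, ?_⟩
      rw [map_add, Ideal.Quotient.eq_zero_iff_mem.mpr hz, zero_add]
      rfl
    · rintro ⟨x, hx⟩
      obtain ⟨x, rfl⟩ := Ideal.Quotient.mk_surjective x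
      rw [← hx]
      exact Ideal.Quotient.eq_zero_iff_mem.mpr
        (Ideal.mem_sup_right (Ideal.mem_span_singleton'.mpr ⟨x, rfl⟩))
  refine ⟨ShortComplex.mk (ModuleCat.ofHom f) (ModuleCat.ofHom g) ?_, ?_, rfl, rfl, rfl⟩
  · rw [← ModuleCat.ofHom_comp, hfg.linearMap_comp_eq_zero]
    rfl
  · exact { exact := (ShortComplex.ShortExact.moduleCat_exact_iff_function_exact _).mpr hfg
            mono_f := (ModuleCat.mono_iff_injective _).mpr hf
            epi_g := (ModuleCat.epi_iff_surjective _).mpr hg }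

lemma CategoryTheory.ShortComplex.ShortExact.projectiveDimension_X₂_eq {C : Type*} [Category C]
    [Abelian C] {T : ShortComplex C} (hT : T.ShortExact)
    (h : projectiveDimension T.X₁ < projectiveDimension T.X₂) :
    projectiveDimension T.X₂ = projectiveDimension T.X₃ := by
  refine le_antisymm ?_ ?_
  · refine projectiveDimension_le_of_forall_hasProjectiveDimensionLT fun n h₃ ↦ ?_
    by_cases h₁ : HasProjectiveDimensionLT T.X₁ n
    · exact hT.hasProjectiveDimensionLT_X₂ n h₁ h₃
    -- Here `n ≤ pd X₁`. If `pd X₁` is a finite `a`, then `X₁` and `X₃` have dimension at most `a`,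
    -- hence so does `X₂`, against strictness.
    · exfalso
      rw [← projectiveDimension_ge_iff] at h₁
      generalize hd : projectiveDimension T.X₁ = d at h h₁
      induction d with
      | bot => exact absurd h₁ (not_le_of_gt (WithBot.bot_lt_coe _))
      | coe d =>
        induction d with
        | top => exact not_top_lt h
        | coe a =>
          have hna : n ≤ a + 1 := (Nat.cast_le.mp (WithBot.coe_le_coe.mp h₁)).trans a.le_succ
          have hX₂ := hT.hasProjectiveDimensionLT_X₂ (a + 1)
            ((projectiveDimension_le_iff _ _).mp hd.le) (hasProjectiveDimensionLT_of_ge _ n _ hna)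
          exact not_lt_of_ge ((projectiveDimension_le_iff _ _).mpr hX₂) h
  · refine projectiveDimension_le_of_forall_hasProjectiveDimensionLT fun n h₂ ↦ ?_
    rcases n with _ | n
    · rw [(projectiveDimension_eq_bot_iff _).mpr (isZero_of_hasProjectiveDimensionLT_zero T.X₂)] at h
      exact absurd h not_lt_bot
    -- Strictness supplies the bound on `X₁` that is one better than the bound on `X₂`.
    · refine hT.hasProjectiveDimensionLT_X₃ n (projectiveDimension_lt_iff.mp ?_) h₂
      refine h.trans_le ?_
      exact (projectiveDimension_le_iff _ _).mpr h₂

lemma IsSquarefreeMonomialIdeal.quotientPd_eq_or {σ k : Type*} [Field k]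
    {I : Ideal (MvPolynomial σ k)} (hI : IsSquarefreeMonomialIdeal I) (v : σ) :
    quotientPd I = quotientPd (Submodule.colon I {(MvPolynomial.X v : MvPolynomial σ k)}) ∨
      quotientPd I = quotientPd (I ⊔ Ideal.span {(MvPolynomial.X v : MvPolynomial σ k)}) := by
  refine (hI.quotientPd_colon_X_le v).eq_or_lt.imp Eq.symm fun h ↦ ?_
  obtain ⟨T, hT, h₁, h₂, h₃⟩ := exists_shortExact_colon I (MvPolynomial.X v)
  have := hT.projectiveDimension_X₂_eq
  rw [h₁, h₂, h₃] at this
  exact this h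

theorem mainTheorem9 {σ : Type*} [Finite σ] {k : Type*} [Field k]
    (I : Ideal (MvPolynomial σ k)) (hI : IsSquarefreeMonomialIdeal I)
    (i : ℕ) (x : Fin i → σ) (hx : Function.Injective x) :
    (∃ j : Fin i, quotientPd I =
      quotientPd (Submodule.colon
        (I ⊔ Ideal.span ((fun l : Fin i => (MvPolynomial.X (x l) : MvPolynomial σ k)) '' Set.Iio j))
        {(MvPolynomial.X (x j) : MvPolynomial σ k)})) ∨
    quotientPd I =
      quotientPd
        (I ⊔ Ideal.span (Set.range fun l : Fin i => (MvPolynomial.X (x l) : MvPolynomial σ k))) := by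
  -- Indices start at 0, so `K j` contains exactly the adjoined variables preceding `x j`.
  let K (m : ℕ) : Ideal (MvPolynomial σ k) :=
    I ⊔ Ideal.span ((fun l : Fin i ↦ MvPolynomial.X (x l)) '' {l : Fin i | l.1 < m})
  have hK (m : ℕ) : IsSquarefreeMonomialIdeal (K m) := by
    have := hI.sup_span_X (x '' {l : Fin i | l.1 < m})
    rwa [Set.image_image] at this
  have hK_succ (j : Fin i) : K (j + 1) = K j ⊔ Ideal.span {MvPolynomial.X (x j)} := by
    have : {l : Fin i | l.1 < j.1 + 1} = {l : Fin i | l.1 < j.1} ∪ {j} := by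
      ext l
      simp [← Fin.val_inj, le_iff_eq_or_lt, -Fin.val_fin_le]
    simp only [K, this, Set.image_union, Set.image_singleton, Ideal.span_union, sup_assoc]
  by_cases h : ∃ j : Fin i, quotientPd I =
    quotientPd (Submodule.colon (K j) {(MvPolynomial.X (x j) : MvPolynomial σ k)})
  · exact .inl h
  · right
    have hind (m : ℕ) (hm : m ≤ i) : quotientPd I = quotientPd (K m) := by
      induction m with
      | zero => simp [K]
      | succ m ih =>
        have ih := ih (by omega)
        rw [hK_succ ⟨m, hm⟩, ih]
        refine ((hK m).quotientPd_eq_or _).resolve_left fun h' ↦ h ⟨⟨m, hm⟩, ih.trans h'⟩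
    have := hind i le_rfl
    simpa [K] using this
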